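/- **Conventions.** Let $U(p,b)$ be an additively optimal partial computable machine ($p$ a binary program, $b$ a condition; finite objects are identified with natural numbers by a standard encoding): for every partial computable $V$ there is a constant $c_V$ such that whenever $V(p,b)=a$ there is $q$ with $|q|\le|p|+c_V$ and $U(q,b)=a$. Let $C(a\mid b)=\min\{|p| : U(p,b)=a\}$ and $C(y)=C(y\mid\epsilon)$ be plain Kolmogorov complexity. A total protocol $P$ on inputs of length $n$ is a finite binary tree: at each inner node a fixed party (Alice, holding $x\in\{0,1\}^n$, or Bob, holding $y\in\{0,1\}^n$) sends one bit depending on her or his own input, which selects the next node; at a leaf Alice outputs a string depending on the leaf and on $x$. The number of bits exchanged on $(x,y)$ is $CC^P(x,y)$, and $C(P\mid n)$ is the complexity of $P$ (tree, with its functions listed as tables). For $\alpha\in\mathbb N$ let $TCC_I^{\alpha}(x,y)$ be the minimum of $CC^P(x,y)$ over all total protocols $P$ with $C(P\mid n)\le\alpha$ by which Alice outputs $y'$ on every input pair $(x',y')\in\{0,1\}^n\times\{0,1\}^n$ ($\infty$ if there is none). Write $L(n)=\lfloor\log_2(n+2)\rfloor$. **Statement.** There is a constant $c$, depending only on $U$,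 such that the following hold. 1. For all $n,k$ with $c\,L(n)\le k\le n$: (a) there is $y\in\{0,1\}^n$ with $|C(y)-k|\le c$ such that for every $x\in\{0,1\}^n$ and every $\alpha<C(y)-c\,L(n)$ we have $TCC_I^{\alpha}(x,y)\ge n-\alpha-c\,L(n)$; (b) for every $\alpha\in\mathbb N$ there is $y\in\{0,1\}^n$ with $|C(y)-k|\le c$ such that, if $\alpha<C(y)-c\,L(n)$, then $TCC_I^{\alpha}(x,y)\ge n-\alpha$ for every $x\in\{0,1\}^n$. 2. For all $n$, all $x,y\in\{0,1\}^n$ and all $\alpha\ge C(y)+c$ we have $TCC_I^{\alpha}(x,y)\le c$. -/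

import Mathlib

namespace IndividualCC

/-! ### Plain Kolmogorov complexity

Finite objects are identified with natural numbers through their standard `Encodable` codes. -/

/-- A machine maps a binary program and (the code of) a condition to (the code of) an output,
whenever it halts. -/
abbrev Machine := List Bool → ℕ →. ℕ

/-- `U` is a reference machine: it is partial computable and additively optimal, i.e. it simulates
every partial computable machine with a constant overhead in program length. -/
def IsOptimal (U : Machine) : Prop :=
  Partrec₂ U ∧ ∀ V : Machine, Partrec₂ V →
    ∃ c : ℕ, ∀ (p : List Bool) (b a : ℕ), a ∈ V p b →
      ∃ q : List Bool, q.length ≤ p.length + c ∧ a ∈ U q b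

/-- The conditional plain complexity `C(a | b)` on codes: the least length of a program from which
`U` computes `a` given `b`. -/
noncomputable def condC (U : Machine) (a b : ℕ) : ℕ∞ :=
  ⨅ (p : List Bool) (_ : a ∈ U p b), (p.length : ℕ∞)

/-- The plain complexity `C(y)` of a binary string (the condition is the empty string, whose code
is `0`). -/
noncomputable def strC (U : Machine) (y : List Bool) : ℕ∞ :=
  condC U (Encodable.encode y) (Encodable.encode ([] : List Bool))

/-! ### Communication protocols -/

/-- Binary strings of length `n`. -/
abbrev Str (n : ℕ) := List.Vector Bool n

/-- All binary strings of length `n`, in lexicographic order. -/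
def strings : (n : ℕ) → List (Str n)
  | 0 => [List.Vector.nil]
  | n + 1 => (strings n).map (List.Vector.cons false) ++ (strings n).map (List.Vector.cons true)

/-- A (total, deterministic, two-way) protocol on inputs of length `n`: a finite binary tree.  At an
internal node one of the parties sends one bit that depends on the party's own input, and the
conversation continues in the first subtree if the bit is `false`, in the second if it is `true`.
At a leaf Alice outputs a string that depends on her input (and on the leaf). -/
inductive Protocol (n : ℕ) : Type
  | output (g : Str n → List Bool) : Protocol n
  | alice (f : Str n → Bool) (P Q : Protocol n) : Protocol n
  | bob (f : Str n → Bool) (P Q : Protocol n) : Protocol n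

namespace Protocol

variable {n : ℕ}

/-- Alice's output when the protocol is run on `(x, y)`. -/
def result : Protocol n → Str n → Str n → List Bool
  | output g, x, _ => g x
  | alice f P Q, x, y => bif f x then Q.result x y else P.result x y
  | bob f P Q, x, y => bif f y then Q.result x y else P.result x y

/-- The number of bits exchanged when the protocol is run on `(x, y)`. -/
def cost : Protocol n → Str n → Str n → ℕ
  | output _, _, _ => 0
  | alice f P Q, x, y => (bif f x then Q.cost x y else P.cost x y) + 1
  | bob f P Q, x, y => (bif f y then Q.cost x y else P.cost x y) + 1

/-- The protocol computes `f` correctly on all pairs of inputs of length `n`. -/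
def Computes (P : Protocol n) (f : Str n → Str n → List Bool) : Prop :=
  ∀ x y, P.result x y = f x y

/-- The code of a protocol, a finite object: its tree, with the functions at the nodes listed as
tables of values. -/
def code : Protocol n → ℕ
  | output g => Nat.pair 0 (Encodable.encode ((strings n).map g))
  | alice f P Q =>
      Nat.pair 1 (Nat.pair (Encodable.encode ((strings n).map f)) (Nat.pair P.code Q.code))
  | bob f P Q =>
      Nat.pair 2 (Nat.pair (Encodable.encode ((strings n).map f)) (Nat.pair P.code Q.code))

/-- The complexity `C(P | n)` of a protocol. -/
noncomputable def complexity (U : Machine) (P : Protocol n) : ℕ∞ :=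
  condC U P.code n

end Protocol

/-- `TCC_f^α(x, y)`: the least number of bits exchanged on `(x, y)`, over all total protocols of
complexity at most `α` that compute `f` correctly on all inputs (`⊤` if there is none). -/
noncomputable def TCC (U : Machine) {n : ℕ} (f : Str n → Str n → List Bool) (α : ℕ)
    (x y : Str n) : ℕ∞ :=
  ⨅ (P : Protocol n) (_ : P.Computes f ∧ P.complexity U ≤ α), (P.cost x y : ℕ∞)

/-- The identity function `I(x, y) = y`. -/
def identity {n : ℕ} (_ y : Str n) : List Bool := y.toList

/-! ### Sanity checks: optimal machines exist, and the code determines the protocol -/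

theorem exists_isOptimal : ∃ U : Machine, IsOptimal U := by
  refine ⟨fun p b => (Denumerable.ofNat Nat.Partrec.Code (p.takeWhile id).length).eval
    (Nat.pair (Encodable.encode (p.dropWhile id).tail) b), ?_, ?_⟩
  · have h1 : Computable₂ fun (p : List Bool) (_ : ℕ) =>
        Denumerable.ofNat Nat.Partrec.Code (p.takeWhile id).length :=
      ((Primrec.ofNat Nat.Partrec.Code).comp (Primrec.list_length.comp
        ((Primrec.list_takeWhile Primrec.id).comp Primrec.fst))).to_comp
    have h2 : Computable₂ fun (p : List Bool) (b : ℕ) =>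
        Nat.pair (Encodable.encode (p.dropWhile id).tail) b :=
      (Primrec₂.natPair.comp (Primrec.encode.comp (Primrec.list_tail.comp
        ((Primrec.list_dropWhile Primrec.id).comp Primrec.fst))) Primrec.snd).to_comp
    exact Nat.Partrec.Code.eval_part.comp h1 h2
  · intro V hV
    obtain ⟨e, he⟩ := Nat.Partrec.Code.exists_code.1 hV
    refine ⟨Encodable.encode e + 1, fun p b a ha =>
      ⟨List.replicate (Encodable.encode e) true ++ false :: p, ?_, ?_⟩⟩
    · simp; omega
    · have h1 : (List.replicate (Encodable.encode e) true ++ false :: p).takeWhile id =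
          List.replicate (Encodable.encode e) true := by
        generalize Encodable.encode e = m
        induction m with
        | zero => simp
        | succ m ih => simp [List.replicate_succ, ih]
      have h2 : (List.replicate (Encodable.encode e) true ++ false :: p).dropWhile id =
          false :: p := by
        generalize Encodable.encode e = m
        induction m with
        | zero => simp
        | succ m ih => simp [List.replicate_succ, ih]
      change a ∈ Nat.Partrec.Code.eval (Denumerable.ofNat Nat.Partrec.Code
        ((List.replicate (Encodable.encode e) true ++ false :: p).takeWhile id).length)
        (Nat.pair (Encodable.encode
          ((List.replicate (Encodable.encode e) true ++ false :: p).dropWhile id).tail) b)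
      rw [h1, h2, List.length_replicate, Denumerable.ofNat_encode, he]
      have h3 : Encodable.decode (α := List Bool × ℕ)
          (Nat.pair (Encodable.encode p) b) = some (p, b) := by
        rw [← Encodable.encodek (p, b)]; simp
      simp only [List.tail_cons, h3]
      simpa using ha

theorem mem_strings : ∀ {n : ℕ} (x : Str n), x ∈ strings n
  | 0, x => by simp [strings, List.Vector.eq_nil x]
  | n + 1, x => by
    obtain ⟨b, t, rfl⟩ := x.exists_eq_cons
    have := mem_strings t
    rw [strings, List.mem_append, List.mem_map, List.mem_map]
    cases b
    · exact Or.inl ⟨t, this, rfl⟩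
    · exact Or.inr ⟨t, this, rfl⟩

theorem Protocol.code_injective {n : ℕ} :
    Function.Injective (Protocol.code : Protocol n → ℕ) := by
  have key : ∀ {β : Type} [Encodable β] (f g : Str n → β),
      Encodable.encode ((strings n).map f) = Encodable.encode ((strings n).map g) → f = g := by
    intro β _ f g h
    have h' := Encodable.encode_injective h
    rw [List.map_inj_left] at h'
    exact funext fun x => h' x (mem_strings x)
  intro P
  induction P with
  | output g =>
    intro Q h
    cases Q <;> simp only [Protocol.code, Nat.pair_eq_pair] at h
    · rw [key _ _ h.2]
    · omega
    · omega
  | alice f P₁ P₂ ih₁ ih₂ =>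
    intro Q h
    cases Q <;> simp only [Protocol.code, Nat.pair_eq_pair] at h
    · omega
    · rw [key _ _ h.2.1, ih₁ h.2.2.1, ih₂ h.2.2.2]
    · omega
  | bob f P₁ P₂ ih₁ ih₂ =>
    intro Q h
    cases Q <;> simp only [Protocol.code, Nat.pair_eq_pair] at h
    · omega
    · omega
    · rw [key _ _ h.2.1, ih₁ h.2.2.1, ih₂ h.2.2.2]

end IndividualCC

/-!
By a protocol that tells Alice the input of Bob, a leaf serves only one `y`, so at most `2 ^ d`
strings `y` can be sent with at most `d` bits, whatever the `x`. Applied with `d = n - α - e - 1` to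
the outputs of all programs of length at most `α`, this shows that the strings `y` that violate the
bound `n ≤ TCC x y + α + e` do not exhaust the strings of length `n`. A logarithmic `e` makes room
for all `α` at once. For a single `α` even `e = 0` suffices: `2 ^ (α + 1)` programs that cover
`2 ^ (n - α - 1)` strings each could just cover everything, but a constant fraction of the programs
output no protocol at all. In both cases some string `y` obeys the bound and has complexity at
least `k - O(1)`.

To bound the complexity of the first such `y` from above, run all programs in parallel. The current
set of violating strings changes only when a program of length at most `hi` halts, that is, fewer
than `2 ^ (hi + 1)` times; the current `y` is also replaced when it turns out to have complexity
less than `k - O(1)`, but there are fewer than `2 ^ k` such strings. With `hi = k - O(log n)`, at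
most `2 ^ (k + 1)` strings are ever candidates, for all parameters together, so the index of `y` in
their enumeration, written with `k + 1` bits, is a description of `y`.

For the upper bound, Bob first tests whether his input is `y` and sends one bit if so.
-/

namespace IndividualCC

/-! ### Lists of binary strings -/

/-- The binary strings of length `n`, as lists, in lexicographic order. -/
def boolLists (n : ℕ) : List (List Bool) := (strings n).map List.Vector.toList

theorem length_strings (n : ℕ) : (strings n).length = 2 ^ n := by
  induction n with
  | zero => rfl
  | succ n ih => simp only [strings, List.length_append, List.length_map, ih, pow_succ, mul_two]

theorem nodup_strings : ∀ n, (strings n).Nodup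
  | 0 => List.nodup_singleton _
  | n + 1 => by
    have hcons (b : Bool) : Function.Injective (List.Vector.cons b : Str n → Str (n + 1)) :=
      fun v w h => by simpa using congrArg List.Vector.tail h
    refine ((nodup_strings n).map (hcons _)).append ((nodup_strings n).map (hcons _)) ?_
    rintro _ hfalse htrue
    obtain ⟨v, -, rfl⟩ := List.mem_map.1 hfalse
    obtain ⟨w, -, hvw⟩ := List.mem_map.1 htrue
    simpa using congrArg List.Vector.head hvw

theorem length_boolLists (n : ℕ) : (boolLists n).length = 2 ^ n := by
  rw [boolLists, List.length_map, length_strings]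

theorem mem_boolLists {n : ℕ} {l : List Bool} : l ∈ boolLists n ↔ l.length = n := by
  refine List.mem_map.trans ⟨?_, fun h => ⟨⟨l, h⟩, mem_strings _, rfl⟩⟩
  rintro ⟨x, -, rfl⟩
  exact x.toList_length

theorem nodup_boolLists (n : ℕ) : (boolLists n).Nodup :=
  (nodup_strings n).map Subtype.val_injective

theorem boolLists_succ (n : ℕ) : boolLists (n + 1) =
    (boolLists n).map (List.cons false) ++ (boolLists n).map (List.cons true) := by
  simp only [boolLists, strings, List.map_append, List.map_map]
  rfl

theorem primrec_boolLists : Primrec boolLists := by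
  have hcons (b : Bool) : Primrec fun L : List (List Bool) => L.map (List.cons b) :=
    Primrec.list_map Primrec.id (Primrec.list_cons.comp (Primrec.const b) Primrec.snd).to₂
  refine (Primrec.nat_rec₁ (f := fun _ L =>
    L.map (List.cons false) ++ L.map (List.cons true)) [[]] ?_).of_eq fun n => ?_
  · exact (Primrec.list_append.comp ((hcons false).comp Primrec.snd)
      ((hcons true).comp Primrec.snd)).to₂
  · induction n with
    | zero => rfl
    | succ n ih => simp only [boolLists_succ, ← ih]

/-- The binary strings of length less than `m`: the possible programs for objects of complexity
less than `m`. -/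
def programs (m : ℕ) : List (List Bool) := (List.range m).flatMap boolLists

theorem mem_programs {m : ℕ} {p : List Bool} : p ∈ programs m ↔ p.length < m := by
  simp [programs, mem_boolLists]

theorem length_programs (m : ℕ) : (programs m).length + 1 = 2 ^ m := by
  induction m with
  | zero => rfl
  | succ m ih =>
    have hsucc : programs (m + 1) = programs m ++ boolLists m := by
      simp only [programs, List.range_succ, List.flatMap_append, List.flatMap_singleton]
    rw [hsucc, List.length_append, length_boolLists, pow_succ]
    omega

theorem card_toFinset_programs_lt (m : ℕ) : (programs m).toFinset.card < 2 ^ m := by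
  have := length_programs m
  have := List.toFinset_card_le (programs m)
  omega

theorem primrec_programs : Primrec programs :=
  Primrec.list_flatMap Primrec.list_range (primrec_boolLists.comp Primrec.snd).to₂

theorem sum_toFinset_programs (m : ℕ) (f : ℕ → ℕ) :
    ∑ p ∈ (programs m).toFinset, f p.length = ∑ l ∈ Finset.range m, 2 ^ l * f l := by
  have hmem : ∀ p ∈ (programs m).toFinset, p.length ∈ Finset.range m := fun p hp =>
    Finset.mem_range.2 (mem_programs.1 (List.mem_toFinset.1 hp))
  rw [← Finset.sum_fiberwise_of_maps_to hmem]
  refine Finset.sum_congr rfl fun l hl => ?_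
  have hfiber : {p ∈ (programs m).toFinset | p.length = l} = (boolLists l).toFinset := by
    ext p
    simp only [Finset.mem_filter, List.mem_toFinset, mem_programs, mem_boolLists]
    have := Finset.mem_range.1 hl
    omega
  have hconst : ∀ p ∈ (boolLists l).toFinset, f p.length = f l := fun p hp =>
    congrArg f (mem_boolLists.1 (List.mem_toFinset.1 hp))
  rw [hfiber, Finset.sum_congr rfl hconst, Finset.sum_const,
    List.toFinset_card_of_nodup (nodup_boolLists l), length_boolLists, smul_eq_mul]

/-- The rank of a binary string in the lexicographic order of the strings of its length. -/
def position (y : List Bool) : ℕ := (boolLists y.length).idxOf y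

theorem primrec_position : Primrec position := by
  refine (Primrec.list_idxOf.comp Primrec.id
    (primrec_boolLists.comp Primrec.list_length)).of_eq fun y => ?_
  rw [position, lawful_beq_subsingleton List.instBEq instBEqOfDecidableEq]
  rfl

theorem getElem?_position (y : List Bool) : (boolLists y.length)[position y]? = some y :=
  List.getElem?_idxOf (mem_boolLists.2 rfl)

theorem exists_position_eq {k i : ℕ} (hi : i < 2 ^ k) : ∃ p, p.length = k ∧ position p = i := by
  rw [← length_boolLists] at hi
  have hlength : ((boolLists k)[i]).length = k := mem_boolLists.1 (List.getElem_mem hi)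
  refine ⟨(boolLists k)[i], hlength, ?_⟩
  rw [position, hlength]
  exact (nodup_boolLists k).idxOf_getElem i hi

/-! ### Plain complexity -/

section Complexity

variable {U : Machine}

theorem condC_lt_iff {a b m : ℕ} : condC U a b < m ↔ ∃ p, p.length < m ∧ a ∈ U p b := by
  simp only [condC, iInf_lt_iff, Nat.cast_lt, exists_prop, and_comm]

theorem condC_le_iff {a b m : ℕ} : condC U a b ≤ m ↔ ∃ p, p.length ≤ m ∧ a ∈ U p b := by
  rw [← ENat.lt_natCast_add_one_iff]
  exact_mod_cast condC_lt_iff.trans (by simp only [Nat.lt_succ_iff])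

theorem encard_condC_lt {α : Type*} [Encodable α] (b m : ℕ) :
    {a : α | condC U (Encodable.encode a) b < m}.encard < (2 ^ m : ℕ) := by
  choose! p hp hout using fun (a : α) (h : condC U (Encodable.encode a) b < m) => condC_lt_iff.1 h
  refine lt_of_le_of_lt ?_ (Nat.cast_lt.2 (card_toFinset_programs_lt m))
  rw [← Set.encard_coe_eq_coe_finsetCard]
  refine Set.encard_le_encard_of_injOn (f := p) (fun a ha => ?_) fun a ha a' ha' h => ?_
  · exact List.mem_toFinset.2 (mem_programs.2 (hp a ha))
  · exact Encodable.encode_injective (Part.mem_unique (hout a ha) (h ▸ hout a' ha'))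

theorem exists_notMem_le_condC (U : Machine) (b : ℕ) {n m : ℕ} {B : List (List Bool)}
    (hB : B.toFinset.card + 2 ^ m ≤ 2 ^ n) :
    ∃ y ∈ boolLists n, y ∉ B ∧ m ≤ condC U (Encodable.encode y) b := by
  by_contra! hall
  have hsub : ((boolLists n).toFinset : Set (List Bool)) ⊆
      B.toFinset ∪ {y | condC U (Encodable.encode y) b < m} := by
    intro y hy
    refine or_iff_not_imp_left.2 fun hyB => hall y (List.mem_toFinset.1 hy) fun h => ?_
    exact hyB (List.mem_toFinset.2 h)
  have hcard := (Set.encard_le_encard hsub).trans (Set.encard_union_le _ _)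
  rw [Set.encard_coe_eq_coe_finsetCard, Set.encard_coe_eq_coe_finsetCard,
    List.toFinset_card_of_nodup (nodup_boolLists n), length_boolLists] at hcard
  have hlt := encard_condC_lt (U := U) (α := List Bool) b m
  obtain ⟨N, hN⟩ := ENat.ne_top_iff_exists.1 hlt.ne_top
  rw [← hN] at hcard hlt
  norm_cast at hcard hlt
  omega

theorem IsOptimal.exists_condC_le (hU : IsOptimal U) {V : Machine} (hV : Partrec₂ V) :
    ∃ c : ℕ, ∀ (p : List Bool) (b a : ℕ), a ∈ V p b → condC U a b ≤ (p.length + c : ℕ) := by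
  obtain ⟨c, hc⟩ := hU.2 V hV
  exact ⟨c, fun p b a ha => condC_le_iff.2 (hc p b a ha)⟩

theorem IsOptimal.exists_condC_le_condC_add (hU : IsOptimal U) {α : Type*} [Primcodable α]
    {g : α → ℕ → ℕ} (hg : Computable₂ g) (b₀ : ℕ) :
    ∃ c : ℕ, ∀ a b, condC U (g a b) b ≤ condC U (Encodable.encode a) b₀ + c := by
  let V : Machine := fun p b => (U p b₀).bind fun m =>
    ((Encodable.decode m).map (g · b) : Option ℕ)
  have hV : Partrec₂ V := by
    refine Partrec.bind (hU.1.comp Computable.fst (Computable.const b₀)) ?_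
    exact Computable.ofOption (Computable.option_map (Computable.decode.comp Computable.snd)
      (hg.comp Computable.snd (Computable.snd.comp (Computable.fst.comp Computable.fst))).to₂)
  obtain ⟨c, hc⟩ := hU.exists_condC_le hV
  refine ⟨c, fun a b => ?_⟩
  rcases eq_or_ne (condC U (Encodable.encode a) b₀) ⊤ with htop | hfin
  · rw [htop, top_add]
    exact le_top
  obtain ⟨m, hm⟩ := ENat.ne_top_iff_exists.1 hfin
  obtain ⟨p, hp, hout⟩ := condC_le_iff.1 hm.ge
  have hV_out : g a b ∈ V p b :=
    Part.mem_bind_iff.2 ⟨_, hout, by rw [Encodable.encodek]; exact Part.mem_some _⟩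
  rw [← hm]
  exact (hc p b _ hV_out).trans (by exact_mod_cast Nat.add_le_add_right hp c)

/-- `U` simulates `p ↦ g p` with constant overhead, so that a constant fraction of its programs
output values of `g`. -/
theorem IsOptimal.exists_card_add_pow_le (hU : IsOptimal U) {g : List Bool → ℕ}
    (hg : Computable g) (hinj : Function.Injective g) :
    ∃ c : ℕ, ∀ (b m : ℕ) (S : Finset (List Bool)),
      (∀ p ∈ S, p.length ≤ m ∧ ∀ q, g q ∉ U p b) → S.card + 2 ^ (m - c) ≤ 2 ^ (m + 1) := by
  obtain ⟨c, hc⟩ := hU.2 (fun p _ => Part.some (g p)) (hg.comp Computable.fst).partrec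
  refine ⟨c, fun b m S hS => ?_⟩
  have hprograms := card_toFinset_programs_lt (m + 1)
  have hsub : S ⊆ (programs (m + 1)).toFinset := fun p hp =>
    List.mem_toFinset.2 (mem_programs.2 (Nat.lt_succ_of_le (hS p hp).1))
  rcases lt_or_ge m c with hmc | hcm
  · have := Finset.card_le_card hsub
    rw [Nat.sub_eq_zero_of_le hmc.le, pow_zero]
    omega
  choose q hq hout using fun p => hc p b (g p) (Part.mem_some _)
  let D := (boolLists (m - c)).toFinset.image q
  have hD : D.card = 2 ^ (m - c) := by
    rw [Finset.card_image_of_injective, List.toFinset_card_of_nodup (nodup_boolLists _),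
      length_boolLists]
    exact fun p p' h => hinj (Part.mem_unique (hout p) (h ▸ hout p'))
  have hD_sub : D ⊆ (programs (m + 1)).toFinset := by
    refine Finset.image_subset_iff.2 fun p hp => List.mem_toFinset.2 (mem_programs.2 ?_)
    have := hq p
    have := mem_boolLists.1 (List.mem_toFinset.1 hp)
    omega
  have hdisj : Disjoint S D := Finset.disjoint_left.2 fun p hp hpD => by
    obtain ⟨p', -, rfl⟩ := Finset.mem_image.1 hpD
    exact (hS _ hp).2 p' (hout p')
  rw [← hD, ← Finset.card_union_of_disjoint hdisj]
  exact (Finset.card_le_card (Finset.union_subset hsub hD_sub)).trans hprograms.le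

end Complexity

/-! ### Enumerated sets -/

theorem primrecRel_mem {α : Type*} [Primcodable α] :
    PrimrecRel fun (a : α) (l : List α) => a ∈ l :=
  ((PrimrecRel.exists_mem_list Primrec.eq).comp Primrec.snd Primrec.fst).of_eq (by simp)

section Enumeration

variable {α : Type*} [DecidableEq α]

/-- The values of the enumeration `E` before time `s`, without repetitions, in the order of their
first appearance. -/
def values (E : ℕ → Option α) (s : ℕ) : List α :=
  ((List.range s).reverse.filterMap E).dedup.reverse

theorem mem_values {E : ℕ → Option α} {s : ℕ} {a : α} :
    a ∈ values E s ↔ ∃ t < s, E t = some a := by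
  simp [values]

theorem nodup_values (E : ℕ → Option α) (s : ℕ) : (values E s).Nodup :=
  List.nodup_reverse.2 (List.nodup_dedup _)

theorem values_prefix (E : ℕ → Option α) {s t : ℕ} (h : s ≤ t) : values E s <+: values E t := by
  induction t, h using Nat.le_induction with
  | base => exact List.prefix_refl _
  | succ t _ ih =>
    refine ih.trans (List.reverse_prefix.2 ?_)
    rw [List.range_succ, List.reverse_concat, List.filterMap_cons]
    cases E t with
    | none => exact List.suffix_refl _
    | some a =>
      dsimp only
      rw [List.dedup_cons]
      split_ifs
      exacts [List.suffix_refl _, List.suffix_cons _ _]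

theorem primrec_dedup [Primcodable α] : Primrec (List.dedup (α := α)) := by
  refine (Primrec.list_foldr (h := fun (_ : List α) (q : α × List α) =>
    if q.1 ∈ q.2 then q.2 else q.1 :: q.2) Primrec.id (Primrec.const []) ?_).of_eq fun l => ?_
  · exact (Primrec.ite (primrecRel_mem.comp Primrec.fst Primrec.snd) Primrec.snd
      (Primrec.list_cons.comp Primrec.fst Primrec.snd)).comp Primrec.snd
  · induction l with
    | nil => rfl
    | cons a l ih =>
      simp only [id_eq, List.foldr_cons] at ih ⊢
      simp only [ih, List.mem_dedup, List.dedup_cons]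

theorem primrec_values [Primcodable α] {E : ℕ → ℕ → Option α} (hE : Primrec₂ E) :
    Primrec₂ fun k s => values (E k) s :=
  Primrec.list_reverse.comp (primrec_dedup.comp
    (Primrec.listFilterMap (Primrec.list_reverse.comp (Primrec.list_range.comp Primrec.snd))
      (hE.comp (Primrec.fst.comp Primrec.fst) Primrec.snd)))

end Enumeration

/-- A program for the entry `i` of the growing list `L k` is the string of length `k + d` and
position `i`. -/
theorem IsOptimal.exists_condC_getElem_le {U : Machine} (hU : IsOptimal U) {α : Type*}
    [Primcodable α] {L : ℕ → ℕ → List α} (hL : Primrec₂ L)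
    (hmono : ∀ k {s t}, s ≤ t → L k s <+: L k t) (d : ℕ) :
    ∃ c : ℕ, ∀ (k s i b : ℕ) (hi : i < (L k s).length), i < 2 ^ (k + d) →
      condC U (Encodable.encode (L k s)[i]) b ≤ (k + c : ℕ) := by
  let V : Machine := fun p _ => Nat.rfindOpt fun s =>
    ((L (p.length - d) s)[position p]?).map Encodable.encode
  have hV : Partrec₂ V := by
    refine Partrec.rfindOpt (Primrec.to_comp ?_)
    have hp : Primrec fun q : (List Bool × ℕ) × ℕ => q.1.1 := Primrec.fst.comp Primrec.fst
    exact Primrec.option_map (Primrec.list_getElem?.comp (hL.comp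
      (Primrec.nat_sub.comp (Primrec.list_length.comp hp) (Primrec.const d)) Primrec.snd)
      (primrec_position.comp hp)) (Primrec.encode.comp Primrec.snd).to₂
  obtain ⟨c, hc⟩ := hU.exists_condC_le hV
  refine ⟨d + c, fun k s i b hi hik => ?_⟩
  obtain ⟨p, hp, hpi⟩ := exists_position_eq hik
  have hV_mono {a m m' : ℕ} (hm : m ≤ m') (h : a ∈ ((L k m)[i]?).map Encodable.encode) :
      a ∈ ((L k m')[i]?).map Encodable.encode := by
    obtain ⟨b, hb, rfl⟩ := Option.map_eq_some_iff.1 h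
    obtain ⟨hi, rfl⟩ := List.getElem?_eq_some_iff.1 hb
    exact Option.map_eq_some_iff.2 ⟨_, List.prefix_iff_getElem?.1 (hmono k hm) i hi, rfl⟩
  have hout : Encodable.encode (L k s)[i] ∈ V p b := by
    simp only [V, hp, hpi, Nat.add_sub_cancel]
    exact (Nat.rfindOpt_mono hV_mono).2
      ⟨s, Option.map_eq_some_iff.2 ⟨_, List.getElem?_eq_getElem hi, rfl⟩⟩
  have hcomplexity := hc p b _ hout
  rwa [hp, add_assoc] at hcomplexity

theorem IsOptimal.exists_condC_le_of_enumeration {U : Machine} (hU : IsOptimal U) {α σ : Type*}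
    [Primcodable α] [Primcodable σ] {E : ℕ → σ → Option α} (hE : Primrec₂ E) (d : ℕ)
    (hcard : ∀ k, {a | ∃ s, E k s = some a}.encard ≤ (2 ^ (k + d) : ℕ)) :
    ∃ c : ℕ, ∀ (k : ℕ) (s : σ) (a : α) (b : ℕ), E k s = some a →
      condC U (Encodable.encode a) b ≤ (k + c : ℕ) := by
  classical
  let E' (k s : ℕ) : Option α := (Encodable.decode s).bind (E k)
  have hE' : Primrec₂ E' := Primrec.option_bind (Primrec.decode.comp Primrec.snd)
    (hE.comp (Primrec.fst.comp Primrec.fst) Primrec.snd).to₂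
  obtain ⟨c, hc⟩ := hU.exists_condC_getElem_le (primrec_values hE')
    (fun k _ _ => values_prefix (E' k)) d
  refine ⟨c, fun k s a b hs => ?_⟩
  have ha : a ∈ values (E' k) (Encodable.encode s + 1) :=
    mem_values.2 ⟨_, Nat.lt_succ_self _, by simp only [E', Encodable.encodek, Option.bind_some, hs]⟩
  have hlength : (values (E' k) (Encodable.encode s + 1)).length ≤ 2 ^ (k + d) := by
    rw [← List.toFinset_card_of_nodup (nodup_values _ _), ← Nat.cast_le (α := ℕ∞),
      ← Set.encard_coe_eq_coe_finsetCard]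
    refine (Set.encard_le_encard fun a ha => ?_).trans (hcard k)
    obtain ⟨t, -, ht⟩ := mem_values.1 (List.mem_toFinset.1 ha)
    obtain ⟨s, -, hs⟩ := Option.bind_eq_some_iff.1 ht
    exact ⟨s, hs⟩
  obtain ⟨i, hi, rfl⟩ := List.getElem_of_mem ha
  exact hc k _ i b hi (hi.trans_le hlength)

/-! ### Approximating a machine from below -/

/-- A primitive recursive approximation of the machine `U`: `run T b p` is the output of `U` on the
program `p` and the condition `b` if it is found by time `T`. -/
structure Approximation (U : Machine) where
  run : ℕ → ℕ → List Bool → Option ℕ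
  primrec_run : Primrec fun q : ℕ × ℕ × List Bool => run q.1 q.2.1 q.2.2
  run_mono : ∀ {T T' b p a}, T ≤ T' → run T b p = some a → run T' b p = some a
  mem_iff : ∀ {p b a}, a ∈ U p b ↔ ∃ T, run T b p = some a

theorem nonempty_approximation {U : Machine} (hU : Partrec₂ U) : Nonempty (Approximation U) := by
  obtain ⟨u, hu⟩ := Nat.Partrec.Code.exists_code.1 hU
  refine ⟨fun T b p => u.evaln T (Nat.pair (Encodable.encode p) b), ?_,
    Nat.Partrec.Code.evaln_mono, fun {p b a} => ?_⟩
  · exact Nat.Partrec.Code.primrec_evaln.comp ((Primrec.fst.pair (Primrec.const u)).pair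
      (Primrec₂.natPair.comp (Primrec.encode.comp (Primrec.snd.comp Primrec.snd))
        (Primrec.fst.comp Primrec.snd)))
  · have hdecode : Encodable.decode (α := List Bool × ℕ) (Nat.pair (Encodable.encode p) b) =
        some (p, b) := Encodable.encodek (p, b)
    have heval : a ∈ u.eval (Nat.pair (Encodable.encode p) b) ↔ a ∈ U p b := by
      simp [hu, hdecode]
    rw [← heval, Nat.Partrec.Code.evaln_complete]
    rfl

namespace Approximation

variable {U : Machine} (A : Approximation U)

theorem eventually_run_eq_some {p : List Bool} {b a : ℕ} (h : a ∈ U p b) :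
    ∀ᶠ T in Filter.atTop, A.run T b p = some a := by
  obtain ⟨T, hT⟩ := A.mem_iff.1 h
  filter_upwards [Filter.eventually_ge_atTop T] with T' hT'
  exact A.run_mono hT' hT

theorem eventually_forall_run_eq_some (m b : ℕ) :
    ∀ᶠ T in Filter.atTop, ∀ p ∈ programs m, ∀ a ∈ U p b, A.run T b p = some a := by
  simp only [← List.mem_toFinset, Filter.eventually_all_finset]
  intro p _
  rcases Part.eq_none_or_eq_some (U p b) with h | ⟨a, h⟩
  · simp [h]
  · simpa [h] using A.eventually_run_eq_some (h ▸ Part.mem_some a)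

/-- The programs of length less than `m` that halt on the condition `b` by time `T`. -/
def halted (m b T : ℕ) : Finset (List Bool) :=
  {p ∈ (programs m).toFinset | (A.run T b p).isSome}

theorem run_eq_of_card_halted_eq {m b T T' : ℕ}
    (h : (A.halted m b T).card = (A.halted m b T').card) {p : List Bool} (hp : p ∈ programs m) :
    A.run T b p = A.run T' b p := by
  wlog hT : T ≤ T' generalizing T T'
  · exact (this h.symm (le_of_not_ge hT)).symm
  have hsub : A.halted m b T ⊆ A.halted m b T' := fun q hq => by
    simp only [halted, Finset.mem_filter, Option.isSome_iff_exists] at hq ⊢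
    exact ⟨hq.1, hq.2.imp fun _ => A.run_mono hT⟩
  have hiff : p ∈ A.halted m b T ↔ p ∈ A.halted m b T' := by
    rw [Finset.eq_of_subset_of_card_le hsub h.ge]
  cases hrun : A.run T b p with
  | some a => exact (A.run_mono hT hrun).symm
  | none =>
    have hnone : A.run T' b p = none := by simpa [halted, hp, hrun] using hiff
    exact hnone.symm

/-- As time passes, a quantity that depends on the programs of length less than `m` changes only
when one of them halts. -/
theorem encard_range_le {β : Type*} (m b : ℕ) (F : (List Bool → Option ℕ) → β)
    (hF : ∀ ev ev', (∀ p ∈ programs m, ev p = ev' p) → F ev = F ev') :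
    (Set.range fun T => F (A.run T b)).encard ≤ (2 ^ m : ℕ) := by
  have hfactors : Function.FactorsThrough (fun T => F (A.run T b))
      fun T => (A.halted m b T).card :=
    fun T T' h => hF _ _ fun p hp => A.run_eq_of_card_halted_eq h hp
  have hcard : Set.range (fun T => (A.halted m b T).card) ⊆ Finset.range (2 ^ m) := by
    rintro _ ⟨T, rfl⟩
    exact Finset.mem_coe.2 (Finset.mem_range.2
      ((Finset.card_filter_le _ _).trans_lt (card_toFinset_programs_lt m)))
  rw [← hfactors.extend_comp fun _ => F (A.run 0 b), Set.range_comp]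
  refine (Set.encard_image_le _ _).trans ((Set.encard_le_encard hcard).trans ?_)
  rw [Set.encard_coe_eq_coe_finsetCard, Finset.card_range]

/-- The objects that are found by time `T` to have complexity less than `m`. -/
def low (m T : ℕ) : List ℕ := (programs m).filterMap (A.run T 0)

theorem mem_low {m T a : ℕ} : a ∈ A.low m T ↔ ∃ p ∈ programs m, A.run T 0 p = some a :=
  List.mem_filterMap

theorem condC_lt_of_mem_low {m T a : ℕ} (h : a ∈ A.low m T) : condC U a 0 < m := by
  obtain ⟨p, hp, hrun⟩ := A.mem_low.1 h
  exact condC_lt_iff.2 ⟨p, mem_programs.1 hp, A.mem_iff.2 ⟨T, hrun⟩⟩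

theorem eventually_mem_low (m : ℕ) :
    ∀ᶠ T in Filter.atTop, ∀ a, condC U a 0 < m → a ∈ A.low m T := by
  filter_upwards [A.eventually_forall_run_eq_some m 0] with T hT a ha
  obtain ⟨p, hp, hout⟩ := condC_lt_iff.1 ha
  exact A.mem_low.2 ⟨p, mem_programs.2 hp, hT p (mem_programs.2 hp) a hout⟩

theorem primrec_low : Primrec₂ A.low :=
  Primrec.listFilterMap (primrec_programs.comp Primrec.fst)
    (A.primrec_run.comp ((Primrec.snd.comp Primrec.fst).pair
      ((Primrec.const 0).pair Primrec.snd))).to₂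

end Approximation

/-! ### Strings that avoid a slowly changing set -/

/-- The weights `1 / ((i + 1) * (i + 2))` have the telescoping partial sums `M / (M + 1)`. -/
theorem card_biUnion_range_mul_le {α : Type*} [DecidableEq α] {N : ℕ → Finset α} {K : ℕ}
    (h : ∀ i, (N i).card * ((i + 1) * (i + 2)) ≤ K) (M : ℕ) :
    ((Finset.range M).biUnion N).card * (M + 1) ≤ M * K := by
  induction M with
  | zero => simp
  | succ M ih =>
    have hunion : ((Finset.range (M + 1)).biUnion N).card ≤
        (N M).card + ((Finset.range M).biUnion N).card := by
      rw [Finset.range_add_one, Finset.biUnion_insert]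
      exact Finset.card_union_le _ _
    refine Nat.le_of_mul_le_mul_left ?_ (Nat.succ_pos M)
    calc (M + 1) * (((Finset.range (M + 1)).biUnion N).card * (M + 1 + 1))
        ≤ (M + 1) * (((N M).card + ((Finset.range M).biUnion N).card) * (M + 1 + 1)) := by gcongr
      _ = (N M).card * ((M + 1) * (M + 2)) +
          (M + 2) * (((Finset.range M).biUnion N).card * (M + 1)) := by ring
      _ ≤ K + (M + 2) * (M * K) := by gcongr; exact h M
      _ = (M + 1) * ((M + 1) * K) := by ring

theorem encard_iUnion_le_of_weights {ι α : Type*} [Encodable ι] {N : ι → Set α} {K : ℕ}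
    (h : ∀ t, (N t).encard * ((Encodable.encode t + 1) * (Encodable.encode t + 2) : ℕ) ≤ K) :
    (⋃ t, N t).encard ≤ K := by
  classical
  have hfinset (i : ℕ) : ∃ F : Finset α, F.card * ((i + 1) * (i + 2)) ≤ K ∧
      ∀ t, Encodable.encode t = i → N t ⊆ F := by
    by_cases hi : ∃ t : ι, Encodable.encode t = i
    · obtain ⟨t, rfl⟩ := hi
      have hfin : (N t).Finite := Set.encard_ne_top_iff.1 fun htop => by
        have := h t
        rw [htop, ENat.top_mul (by positivity)] at this
        exact absurd this (by simp)
      refine ⟨hfin.toFinset, ?_, fun t' ht' => ?_⟩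
      · have := h t
        rw [hfin.encard_eq_coe_toFinset_card] at this
        exact_mod_cast this
      · rw [Encodable.encode_injective ht', hfin.coe_toFinset]
    · exact ⟨∅, by simp, fun t ht => absurd ⟨t, ht⟩ hi⟩
  choose F hF hNF using hfinset
  have hsub : (⋃ t, N t) ⊆ (Finset.range K).biUnion F := by
    refine Set.iUnion_subset fun t a ha => ?_
    have haF := hNF _ t rfl ha
    have hpos : 0 < (F (Encodable.encode t)).card := Finset.card_pos.2 ⟨a, haF⟩
    have := (Nat.le_mul_of_pos_left _ hpos).trans (hF _)
    exact Finset.mem_biUnion.2 ⟨_, Finset.mem_range.2 (by nlinarith), haF⟩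
  refine (Set.encard_le_encard hsub).trans ?_
  rw [Set.encard_coe_eq_coe_finsetCard, Nat.cast_le]
  have := card_biUnion_range_mul_le hF K
  nlinarith

theorem find?_eq_some_of_imp {α : Type*} {l : List α} {P Q : α → Bool} {a : α}
    (h : l.find? P = some a) (hQP : ∀ b, Q b → P b) (ha : Q a) : l.find? Q = some a := by
  rw [List.find?_eq_some_iff_append] at h ⊢
  obtain ⟨-, l₁, l₂, rfl, hl₁⟩ := h
  refine ⟨ha, l₁, l₂, rfl, fun b hb => ?_⟩
  have := hl₁ b hb
  have := hQP b
  grind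

theorem primrec_two_pow : Primrec fun n : ℕ => 2 ^ n :=
  (Primrec.list_length.comp primrec_boolLists).of_eq length_boolLists

section Avoidance

variable {U : Machine} (A : Approximation U) {τ : Type*} [Primcodable τ]
  (len w : τ → ℕ) (bad : τ → ℕ → List (List Bool)) (r : ℕ)

/-- The first string that is neither bad nor known to be of complexity less than `k - r` at time
`T`, for the pairs `(t, T)` such that `t` has few bad sets and a small code, relative to `2 ^ k`. -/
def candidate (k : ℕ) : τ × ℕ → Option (List Bool) := fun (t, T) =>
  if 2 ^ w t * ((Encodable.encode t + 1) * (Encodable.encode t + 2)) ≤ 2 ^ k then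
    (boolLists (len t)).find? fun y => y ∉ bad t T ∧ Encodable.encode y ∉ A.low (k - r) T
  else none

variable {len w bad}

theorem primrec_candidate (hlen : Primrec len) (hw : Primrec w) (hbad : Primrec₂ bad) :
    Primrec₂ (candidate A len w bad r) := by
  have ht : Primrec fun q : ℕ × τ × ℕ => q.2.1 := Primrec.fst.comp Primrec.snd
  have hcode := Primrec.encode.comp ht
  have hweight : PrimrecPred fun q : ℕ × τ × ℕ =>
      2 ^ w q.2.1 * ((Encodable.encode q.2.1 + 1) * (Encodable.encode q.2.1 + 2)) ≤ 2 ^ q.1 :=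
    Primrec.nat_le.comp (Primrec.nat_mul.comp (primrec_two_pow.comp (hw.comp ht))
      (Primrec.nat_mul.comp (Primrec.succ.comp hcode)
      (Primrec.succ.comp (Primrec.succ.comp hcode)))) (primrec_two_pow.comp Primrec.fst)
  have hgood : PrimrecRel fun (y : List Bool) (q : ℕ × τ × ℕ) =>
      y ∉ bad q.2.1 q.2.2 ∧ Encodable.encode y ∉ A.low (q.1 - r) q.2.2 := by
    have hT : Primrec fun q : ℕ × τ × ℕ => q.2.2 := Primrec.snd.comp Primrec.snd
    have hlow : Primrec fun q : ℕ × τ × ℕ => A.low (q.1 - r) q.2.2 :=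
      A.primrec_low.comp (Primrec.nat_sub.comp Primrec.fst (Primrec.const r)) hT
    exact (primrecRel_mem.comp Primrec.fst ((hbad.comp ht hT).comp Primrec.snd)).not.and
      (primrecRel_mem.comp (Primrec.encode.comp Primrec.fst) (hlow.comp Primrec.snd)).not
  exact Primrec.ite hweight ((Primrec.list_head?.comp (hgood.listFilter.comp
    (primrec_boolLists.comp (hlen.comp ht)) Primrec.id)).of_eq fun q => List.head?_filter ..)
    (Primrec.const none)

theorem encard_candidate_le (hchange : ∀ t, (Set.range (bad t)).encard ≤ (2 ^ w t : ℕ)) (k : ℕ) :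
    {y | ∃ s, candidate A len w bad r k s = some y}.encard ≤ (2 ^ (k + 1) : ℕ) := by
  classical
  let first (t : τ) (B : List (List Bool)) : Option (List Bool) := (boolLists (len t)).find?
    fun y => y ∉ B ∧ ¬ condC U (Encodable.encode y) 0 < (k - r : ℕ)
  let N (t : τ) : Set (List Bool) := {y |
    2 ^ w t * ((Encodable.encode t + 1) * (Encodable.encode t + 2)) ≤ 2 ^ k ∧
      ∃ T, first t (bad t T) = some y}
  have hsub : {y | ∃ s, candidate A len w bad r k s = some y} ⊆
      {y | condC U (Encodable.encode y) 0 < (k - r : ℕ)} ∪ ⋃ t, N t := by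
    rintro y ⟨⟨t, T⟩, hy⟩
    refine or_iff_not_imp_left.2 fun hhigh => ?_
    obtain ⟨hw, hfind⟩ := Option.ite_none_right_eq_some.1 hy
    have hgood := List.find?_some hfind
    refine Set.mem_iUnion.2 ⟨t, hw, T, find?_eq_some_of_imp hfind (fun z hz => ?_) ?_⟩
    · simp only [decide_eq_true_eq] at hz ⊢
      exact ⟨hz.1, fun hlow => hz.2 (A.condC_lt_of_mem_low hlow)⟩
    · simp only [decide_eq_true_eq] at hgood ⊢
      exact ⟨hgood.1, hhigh⟩
  have hN (t : τ) :
      (N t).encard * ((Encodable.encode t + 1) * (Encodable.encode t + 2) : ℕ) ≤ (2 ^ k : ℕ) := by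
    by_cases hw : 2 ^ w t * ((Encodable.encode t + 1) * (Encodable.encode t + 2)) ≤ 2 ^ k
    · have himage : N t ⊆ (fun B => (first t B).getD []) '' Set.range (bad t) := by
        rintro y ⟨-, T, hy⟩
        exact ⟨bad t T, Set.mem_range_self T, by simp only [hy, Option.getD_some]⟩
      have hcard := (Set.encard_le_encard himage).trans
        ((Set.encard_image_le _ _).trans (hchange t))
      exact (mul_le_mul_left hcard _).trans (by exact_mod_cast hw)
    · have hempty : N t = ∅ := Set.eq_empty_of_forall_notMem fun y hy => hw hy.1
      simp [hempty]
  calc _ ≤ _ := Set.encard_le_encard hsub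
    _ ≤ _ := Set.encard_union_le _ _
    _ ≤ (2 ^ (k - r) : ℕ) + (2 ^ k : ℕ) :=
      add_le_add (encard_condC_lt 0 (k - r)).le (encard_iUnion_le_of_weights hN)
    _ ≤ (2 ^ (k + 1) : ℕ) := by
      have : 2 ^ (k - r) ≤ 2 ^ k := Nat.pow_le_pow_right two_pos (Nat.sub_le k r)
      exact_mod_cast (by rw [pow_succ]; omega)

theorem IsOptimal.exists_eventually_notMem (hU : IsOptimal U) (hlen : Primrec len) (hw : Primrec w)
    (hbad : Primrec₂ bad) (hchange : ∀ t, (Set.range (bad t)).encard ≤ (2 ^ w t : ℕ)) :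
    ∃ c : ℕ, ∀ t k,
      2 ^ w t * ((Encodable.encode t + 1) * (Encodable.encode t + 2)) ≤ 2 ^ k →
      (∀ T, (bad t T).toFinset.card + 2 ^ (k - r) ≤ 2 ^ len t) →
      ∀ᶠ T in Filter.atTop, ∃ y : Str (len t), y.toList ∉ bad t T ∧
        strC U y.toList ≤ k + c ∧ k ≤ strC U y.toList + r := by
  obtain ⟨A⟩ := nonempty_approximation hU.1
  obtain ⟨c, hc⟩ := hU.exists_condC_le_of_enumeration (primrec_candidate A r hlen hw hbad) 1
    (encard_candidate_le A r hchange)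
  refine ⟨c, fun t k hweight hcard => ?_⟩
  filter_upwards [A.eventually_mem_low (k - r)] with T hlow
  obtain ⟨z, hz, hbad, hhigh⟩ := exists_notMem_le_condC U 0 (hcard T)
  have hgood : z ∉ bad t T ∧ Encodable.encode z ∉ A.low (k - r) T :=
    ⟨hbad, fun h => hhigh.not_gt (A.condC_lt_of_mem_low h)⟩
  obtain ⟨y, hfind⟩ : ∃ y, (boolLists (len t)).find?
      (fun y => y ∉ bad t T ∧ Encodable.encode y ∉ A.low (k - r) T) = some y :=
    Option.isSome_iff_exists.1 (List.find?_isSome.2 ⟨z, hz, decide_eq_true hgood⟩)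
  obtain ⟨hy, hylow⟩ : y ∉ bad t T ∧ Encodable.encode y ∉ A.low (k - r) T := by
    simpa only [decide_eq_true_eq] using List.find?_some hfind
  refine ⟨⟨y, mem_boolLists.1 (List.mem_of_find?_eq_some hfind)⟩, hy, ?_, ?_⟩
  · exact hc k (t, T) y 0 ((if_pos hweight).trans hfind)
  · by_contra! hlt
    refine hylow (hlow _ ?_)
    rw [ENat.natCast_sub, lt_tsub_iff_right]
    exact hlt

end Avoidance

/-! ### A protocol that favours one string -/

namespace Protocol

variable {n : ℕ}

/-- Bob compares his input with the strings of a list one by one, until he finds it. -/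
def chain : List (Str n) → Protocol n
  | [] => output fun _ => []
  | z :: l => bob (fun y => decide (y = z)) (chain l) (output fun _ => z.toList)

theorem result_chain {l : List (Str n)} {y : Str n} (h : y ∈ l) (x : Str n) :
    (chain l).result x y = y.toList := by
  induction l with
  | nil => simp at h
  | cons z l ih =>
    by_cases hz : y = z
    · simp [chain, result, hz]
    · simpa [chain, result, hz] using ih (List.mem_of_ne_of_mem hz h)

theorem cost_chain_cons (l : List (Str n)) (x y : Str n) : (chain (y :: l)).cost x y = 1 := by
  simp [chain, cost]

end Protocol

/-- The code of `Protocol.chain` for the list `l` of strings, where `inputs` is the list of all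
inputs. -/
def chainCode (inputs l : List (List Bool)) : ℕ :=
  l.foldr (fun z a => Nat.pair 2 (Nat.pair (Encodable.encode (inputs.map fun y => decide (y = z)))
    (Nat.pair a (Nat.pair 0 (Encodable.encode (inputs.map fun _ => z))))))
    (Nat.pair 0 (Encodable.encode (inputs.map fun _ => ([] : List Bool))))

theorem Protocol.code_chain {n : ℕ} (l : List (Str n)) :
    (chain l).code = chainCode (boolLists n) (l.map List.Vector.toList) := by
  have hconst (z : List Bool) : (strings n).map (fun _ => z) = (boolLists n).map fun _ => z := by
    rw [boolLists, List.map_map]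
    rfl
  induction l with
  | nil => simp only [chain, code, chainCode, List.map_nil, List.foldr_nil, hconst]
  | cons z l ih =>
    have htest : (strings n).map (fun y => decide (y = z)) =
        (boolLists n).map fun y => decide (y = z.toList) := by
      rw [boolLists, List.map_map]
      exact List.map_congr_left fun y _ => decide_eq_decide.2 Subtype.ext_iff
    simp only [chain, code, ih, hconst, htest, chainCode, List.map_cons, List.foldr_cons]

theorem primrec_chainCode : Primrec₂ chainCode := by
  have hinputs : Primrec fun q : (List (List Bool) × List (List Bool)) × (List Bool × ℕ) =>
      q.1.1 := Primrec.fst.comp Primrec.fst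
  have hz : Primrec fun q : (List (List Bool) × List (List Bool)) × (List Bool × ℕ) => q.2.1 :=
    Primrec.fst.comp Primrec.snd
  have hcode : Primrec fun q : (List (List Bool) × List (List Bool)) × (List Bool × ℕ) => q.2.2 :=
    Primrec.snd.comp Primrec.snd
  have htest : Primrec fun q : List Bool × List Bool => decide (q.1 = q.2) :=
    PrimrecPred.decide (Primrec.eq.comp Primrec.fst Primrec.snd)
  refine Primrec.list_foldr (β := List Bool) (σ := ℕ)
    (h := fun (q : List (List Bool) × List (List Bool)) (r : List Bool × ℕ) =>
      Nat.pair 2 (Nat.pair (Encodable.encode (q.1.map fun y => decide (y = r.1)))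
      (Nat.pair r.2 (Nat.pair 0 (Encodable.encode (q.1.map fun _ => r.1)))))) Primrec.snd ?_ ?_
  · exact Primrec₂.natPair.comp (Primrec.const 0) (Primrec.encode.comp
      (Primrec.list_map Primrec.fst (Primrec.const []).to₂))
  · refine Primrec₂.natPair.comp (Primrec.const 2) (Primrec₂.natPair.comp (Primrec.encode.comp
      (Primrec.list_map hinputs ?_)) (Primrec₂.natPair.comp hcode (Primrec₂.natPair.comp
      (Primrec.const 0) (Primrec.encode.comp (Primrec.list_map hinputs ?_)))))
    · exact (htest.comp (Primrec.snd.pair (hz.comp Primrec.fst))).to₂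
    · exact (hz.comp Primrec.fst).to₂

theorem IsOptimal.exists_TCC_identity_le_one {U : Machine} (hU : IsOptimal U) :
    ∃ c : ℕ, ∀ (n : ℕ) (x y : Str n) (α : ℕ), strC U y.toList + c ≤ α →
      TCC U identity α x y ≤ 1 := by
  have hcode : Computable₂ fun (z : List Bool) n => chainCode (boolLists n) (z :: boolLists n) :=
    (primrec_chainCode.comp (primrec_boolLists.comp Primrec.snd) (Primrec.list_cons.comp Primrec.fst
      (primrec_boolLists.comp Primrec.snd))).to_comp
  obtain ⟨c, hc⟩ := hU.exists_condC_le_condC_add hcode (Encodable.encode ([] : List Bool))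
  refine ⟨c, fun n x y α hα => ?_⟩
  have hcomputes : (Protocol.chain (y :: strings n)).Computes identity := fun x' y' =>
    Protocol.result_chain (List.mem_cons_of_mem _ (mem_strings y')) x'
  have hcomplexity : (Protocol.chain (y :: strings n)).complexity U ≤ α := by
    rw [Protocol.complexity, Protocol.code_chain]
    exact (hc y.toList n).trans hα
  refine (iInf₂_le _ ⟨hcomputes, hcomplexity⟩).trans ?_
  rw [Protocol.cost_chain_cons, Nat.cast_one]

/-! ### Fast inputs of a protocol -/

/-- The entry for the string `x` in a coded table of bits that is indexed by the strings of the same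
length in lexicographic order. -/
def lookup (table : ℕ) (x : List Bool) : Bool :=
  ((Encodable.decode (α := List Bool) table).getD []).getD (position x) false

theorem lookup_encode_map {n : ℕ} (f : Str n → Bool) (x : Str n) :
    lookup (Encodable.encode ((strings n).map f)) x.toList = f x := by
  have hx : (strings n)[position x.toList]? = some x := by
    have hposition := getElem?_position x.toList
    rw [x.toList_length, boolLists, List.getElem?_map] at hposition
    obtain ⟨y, hy, hyx⟩ := Option.map_eq_some_iff.1 hposition
    rw [hy, Subtype.ext hyx]
  rw [lookup, Encodable.encodek, Option.getD_some, List.getD_eq_getElem?_getD, List.getElem?_map,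
    hx, Option.map_some, Option.getD_some]

/-- The code of the protocol that remains after one round of the protocol with code `m` on the
inputs `x` and `y`. Leaves, and numbers that do not code a protocol, are left unchanged. -/
def codeStep (x y : List Bool) (m : ℕ) : ℕ :=
  if m.unpair.1 = 1 ∨ m.unpair.1 = 2 then
    bif lookup m.unpair.2.unpair.1 (if m.unpair.1 = 1 then x else y)
      then m.unpair.2.unpair.2.unpair.2 else m.unpair.2.unpair.2.unpair.1
  else m

theorem primrec_codeStep :
    Primrec fun q : List Bool × List Bool × ℕ => codeStep q.1 q.2.1 q.2.2 := by
  have hm : Primrec fun q : List Bool × List Bool × ℕ => q.2.2.unpair :=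
    Primrec.unpair.comp (Primrec.snd.comp Primrec.snd)
  have htable := Primrec.unpair.comp (Primrec.snd.comp hm)
  have hchildren := Primrec.unpair.comp (Primrec.snd.comp htable)
  have htag (t : ℕ) : PrimrecPred fun q : List Bool × List Bool × ℕ => q.2.2.unpair.1 = t :=
    Primrec.eq.comp (Primrec.fst.comp hm) (Primrec.const t)
  have hinput := Primrec.ite (htag 1) Primrec.fst (Primrec.fst.comp Primrec.snd)
  refine Primrec.ite ((htag 1).or (htag 2)) (Primrec.cond ?_ (Primrec.snd.comp hchildren)
    (Primrec.fst.comp hchildren)) (Primrec.snd.comp Primrec.snd)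
  exact (Primrec.list_getD false).comp (Primrec.option_getD.comp
    (Primrec.decode.comp (Primrec.fst.comp htable)) (Primrec.const []))
    (primrec_position.comp hinput)

theorem codeStep_of_tag {x y : List Bool} {m : ℕ} (h₁ : m.unpair.1 ≠ 1) (h₂ : m.unpair.1 ≠ 2) :
    codeStep x y m = m := if_neg (by tauto)

/-- The inputs of Bob on which, for some input of Alice, the protocol with code `m` ends after at
most `d` rounds. -/
def fastInputs (n d m : ℕ) : List (List Bool) :=
  (boolLists n).filter fun y => ∃ x ∈ boolLists n, ((codeStep x y)^[d] m).unpair.1 = 0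

theorem primrec_fastInputs : Primrec fun q : ℕ × ℕ × ℕ => fastInputs q.1 q.2.1 q.2.2 := by
  have hfast : PrimrecRel fun (x : List Bool) (q : List Bool × ℕ × ℕ × ℕ) =>
      ((codeStep x q.1)^[q.2.2.1] q.2.2.2).unpair.1 = 0 := by
    have hd : Primrec fun q : List Bool × List Bool × ℕ × ℕ × ℕ => q.2.2.2.1 :=
      Primrec.fst.comp (Primrec.snd.comp (Primrec.snd.comp Primrec.snd))
    have hm : Primrec fun q : List Bool × List Bool × ℕ × ℕ × ℕ => q.2.2.2.2 :=
      Primrec.snd.comp (Primrec.snd.comp (Primrec.snd.comp Primrec.snd))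
    have hstep : Primrec₂ fun (q : List Bool × List Bool × ℕ × ℕ × ℕ) (m : ℕ) =>
        codeStep q.1 q.2.1 m :=
      primrec_codeStep.comp ((Primrec.fst.comp Primrec.fst).pair
        ((Primrec.fst.comp (Primrec.snd.comp Primrec.fst)).pair Primrec.snd))
    exact Primrec.eq.comp (Primrec.fst.comp (Primrec.unpair.comp
      (Primrec.nat_iterate hd hm hstep))) (Primrec.const 0)
  have hexists : PrimrecRel fun (y : List Bool) (q : ℕ × ℕ × ℕ) =>
      ∃ x ∈ boolLists q.1, ((codeStep x y)^[q.2.1] q.2.2).unpair.1 = 0 :=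
    (PrimrecRel.exists_mem_list hfast).comp
      (primrec_boolLists.comp (Primrec.fst.comp Primrec.snd)) Primrec.id
  exact hexists.listFilter.comp (primrec_boolLists.comp Primrec.fst) Primrec.id

theorem fastInputs_pair_three (n d m : ℕ) : fastInputs n d (Nat.pair 3 m) = [] := by
  have hfixed (x y : List Bool) : (codeStep x y)^[d] (Nat.pair 3 m) = Nat.pair 3 m :=
    Function.iterate_fixed (codeStep_of_tag (by simp) (by simp)) d
  simp [fastInputs, hfixed]

namespace Protocol

variable {n : ℕ}

theorem codeStep_alice (f : Str n → Bool) (P Q : Protocol n) (x : Str n) (y : List Bool) :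
    codeStep x.toList y (alice f P Q).code = bif f x then Q.code else P.code := by
  simp only [codeStep, code, Nat.unpair_pair, true_or, if_true, lookup_encode_map]

theorem codeStep_bob (f : Str n → Bool) (P Q : Protocol n) (x : List Bool) (y : Str n) :
    codeStep x y.toList (bob f P Q).code = bif f y then Q.code else P.code := by
  simp only [codeStep, code, Nat.unpair_pair, or_true, if_true, lookup_encode_map,
    OfNat.ofNat_ne_one, if_false]

theorem iterate_codeStep_tag_eq_zero_iff (P : Protocol n) (x y : Str n) (d : ℕ) :
    ((codeStep x.toList y.toList)^[d] P.code).unpair.1 = 0 ↔ P.cost x y ≤ d := by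
  induction P generalizing d with
  | output g =>
    rw [Function.iterate_fixed (codeStep_of_tag (by simp [code]) (by simp [code]))]
    simp [code, cost]
  | alice f P Q ihP ihQ =>
    cases d with
    | zero => simp [code, cost]
    | succ d =>
      rw [Function.iterate_succ_apply, codeStep_alice, cost]
      cases f x
      · simpa using ihP d
      · simpa using ihQ d
  | bob f P Q ihP ihQ =>
    cases d with
    | zero => simp [code, cost]
    | succ d =>
      rw [Function.iterate_succ_apply, codeStep_bob, cost]
      cases f y
      · simpa using ihP d
      · simpa using ihQ d

theorem toList_mem_fastInputs_code {P : Protocol n} {d : ℕ} {y : Str n} :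
    y.toList ∈ fastInputs n d P.code ↔ ∃ x, P.cost x y ≤ d := by
  simp only [fastInputs, List.mem_filter, mem_boolLists, y.toList_length, decide_eq_true_eq,
    true_and]
  constructor
  · rintro ⟨x, hx, h⟩
    exact ⟨⟨x, hx⟩, (P.iterate_codeStep_tag_eq_zero_iff ⟨x, hx⟩ y d).1 h⟩
  · rintro ⟨x, h⟩
    exact ⟨x.toList, x.toList_length, (P.iterate_codeStep_tag_eq_zero_iff x y d).2 h⟩

/-- A leaf of a protocol by which Alice learns `g y` serves only one input of Bob. -/
theorem encard_cost_le (P : Protocol n) {X Y : Set (Str n)} {g : Str n → List Bool}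
    (hg : Y.InjOn g) (h : ∀ x ∈ X, ∀ y ∈ Y, P.result x y = g y) (d : ℕ) :
    {y ∈ Y | ∃ x ∈ X, P.cost x y ≤ d}.encard ≤ (2 ^ d : ℕ) := by
  have hunion {S T T' : Set (Str n)} {d : ℕ} (hT : T.encard ≤ (2 ^ d : ℕ))
      (hT' : T'.encard ≤ (2 ^ d : ℕ)) (hS : S ⊆ T ∪ T') : S.encard ≤ (2 ^ (d + 1) : ℕ) := by
    rw [pow_succ, mul_two, Nat.cast_add]
    exact (Set.encard_le_encard hS).trans ((Set.encard_union_le _ _).trans (add_le_add hT hT'))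
  induction P generalizing X Y d with
  | output f =>
    refine (Set.encard_le_one_iff.2 ?_).trans (by exact_mod_cast Nat.one_le_two_pow)
    rintro y y' ⟨hy, x, hx, -⟩ ⟨hy', -⟩
    exact hg hy hy' ((h x hx y hy).symm.trans (h x hx y' hy'))
  | alice f P Q ihP ihQ =>
    cases d with
    | zero => simp [cost]
    | succ d =>
      refine hunion (ihP (X := {x ∈ X | f x = false}) hg ?_ d)
        (ihQ (X := {x ∈ X | f x = true}) hg ?_ d) ?_
      · exact fun x hx y hy => by simpa [result, hx.2] using h x hx.1 y hy
      · exact fun x hx y hy => by simpa [result, hx.2] using h x hx.1 y hy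
      · rintro y ⟨hy, x, hx, hcost⟩
        cases hf : f x
        · exact Or.inl ⟨hy, x, ⟨hx, hf⟩, by simpa [cost, hf] using hcost⟩
        · exact Or.inr ⟨hy, x, ⟨hx, hf⟩, by simpa [cost, hf] using hcost⟩
  | bob f P Q ihP ihQ =>
    cases d with
    | zero => simp [cost]
    | succ d =>
      refine hunion (ihP (X := X) (Y := {y ∈ Y | f y = false}) (hg.mono fun y hy => hy.1) ?_ d)
        (ihQ (X := X) (Y := {y ∈ Y | f y = true}) (hg.mono fun y hy => hy.1) ?_ d) ?_
      · exact fun x hx y hy => by simpa [result, hy.2] using h x hx y hy.1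
      · exact fun x hx y hy => by simpa [result, hy.2] using h x hx y hy.1
      · rintro y ⟨hy, x, hx, hcost⟩
        cases hf : f y
        · exact Or.inl ⟨⟨hy, hf⟩, x, hx, by simpa [cost, hf] using hcost⟩
        · exact Or.inr ⟨⟨hy, hf⟩, x, hx, by simpa [cost, hf] using hcost⟩

theorem length_fastInputs_code_le {P : Protocol n} (hP : P.Computes identity) (d : ℕ) :
    (fastInputs n d P.code).length ≤ 2 ^ d := by
  classical
  have hsub : ((fastInputs n d P.code).toFinset : Set (List Bool)) ⊆
      List.Vector.toList '' {y ∈ Set.univ | ∃ x ∈ Set.univ, P.cost x y ≤ d} := by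
    intro y hy
    have hy := List.mem_toFinset.1 hy
    have hlen : y.length = n := mem_boolLists.1 (List.mem_of_mem_filter hy)
    obtain ⟨x, hx⟩ := toList_mem_fastInputs_code (y := ⟨y, hlen⟩).1 hy
    exact ⟨⟨y, hlen⟩, ⟨Set.mem_univ _, x, Set.mem_univ x, hx⟩, rfl⟩
  have hcard := (Set.encard_le_encard hsub).trans ((Set.encard_image_le _ _).trans
    (P.encard_cost_le Subtype.val_injective.injOn (fun x _ y _ => hP x y) d))
  have hnodup : (fastInputs n d P.code).Nodup := (nodup_boolLists n).filter _
  rwa [Set.encard_coe_eq_coe_finsetCard, List.toFinset_card_of_nodup hnodup, Nat.cast_le] at hcard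

end Protocol

/-! ### Covered strings -/

/-- The fast inputs of the protocol with code `m`, provided that there are at most `2 ^ d` of them,
as is the case when Alice learns the input of Bob. -/
def thinInputs (n d m : ℕ) : List (List Bool) :=
  if (fastInputs n d m).length ≤ 2 ^ d then fastInputs n d m else []

theorem primrec_thinInputs : Primrec fun q : ℕ × ℕ × ℕ => thinInputs q.1 q.2.1 q.2.2 :=
  Primrec.ite (Primrec.nat_le.comp (Primrec.list_length.comp primrec_fastInputs)
    (primrec_two_pow.comp (Primrec.fst.comp Primrec.snd))) primrec_fastInputs (Primrec.const [])

theorem length_thinInputs_le (n d m : ℕ) : (thinInputs n d m).length ≤ 2 ^ d := by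
  rw [thinInputs]
  split_ifs with h
  · exact h
  · exact Nat.zero_le _

theorem Protocol.Computes.toList_mem_thinInputs {n d : ℕ} {P : Protocol n}
    (hP : P.Computes identity) {x y : Str n} (h : P.cost x y ≤ d) :
    y.toList ∈ thinInputs n d P.code := by
  rw [thinInputs, if_pos (P.length_fastInputs_code_le hP d)]
  exact Protocol.toList_mem_fastInputs_code.2 ⟨x, h⟩

/-- The strings `y` of length `n` that would violate the bound `n ≤ TCC x y + α + e` for some `x`
and some `α` between `lo` and `hi`, if the programs of length at most `hi` output protocols as told
by `ev`. -/
def covered (n lo hi e : ℕ) (ev : List Bool → Option ℕ) : List (List Bool) :=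
  (programs (hi + 1)).flatMap fun p =>
    (ev p).toList.flatMap (thinInputs n (n - max lo p.length - e - 1))

theorem primrec_covered {β : Type*} [Primcodable β] {n lo hi e : β → ℕ}
    {ev : β → List Bool → Option ℕ} (hn : Primrec n) (hlo : Primrec lo) (hhi : Primrec hi)
    (he : Primrec e) (hev : Primrec₂ ev) :
    Primrec fun b => covered (n b) (lo b) (hi b) (e b) (ev b) := by
  have hd : Primrec fun q : β × List Bool => n q.1 - max (lo q.1) q.2.length - e q.1 - 1 :=
    Primrec.nat_sub.comp (Primrec.nat_sub.comp (Primrec.nat_sub.comp (hn.comp Primrec.fst)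
      (Primrec.nat_max.comp (hlo.comp Primrec.fst) (Primrec.list_length.comp Primrec.snd)))
      (he.comp Primrec.fst)) (Primrec.const 1)
  have hthin : Primrec₂ fun (q : β × List Bool) (m : ℕ) =>
      thinInputs (n q.1) (n q.1 - max (lo q.1) q.2.length - e q.1 - 1) m :=
    primrec_thinInputs.comp ((hn.comp (Primrec.fst.comp Primrec.fst)).pair
      ((hd.comp Primrec.fst).pair Primrec.snd))
  exact Primrec.list_flatMap (primrec_programs.comp (Primrec.succ.comp hhi))
    (Primrec.list_flatMap (Primrec.optionToList.comp hev) hthin).to₂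

section Covered

variable {n lo hi e : ℕ} {ev ev' : List Bool → Option ℕ}

theorem mem_covered {y : List Bool} : y ∈ covered n lo hi e ev ↔ ∃ p, p.length ≤ hi ∧
    ∃ m, ev p = some m ∧ y ∈ thinInputs n (n - max lo p.length - e - 1) m := by
  simp only [covered, List.mem_flatMap, mem_programs, Option.mem_toList, Nat.lt_succ_iff]

theorem covered_congr (h : ∀ p ∈ programs (hi + 1), ev p = ev' p) :
    covered n lo hi e ev = covered n lo hi e ev' :=
  List.flatMap_congr fun p hp => by rw [h p hp]

theorem card_toFinset_covered_le {S : Finset (List Bool)}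
    (hS : ∀ p m, p.length ≤ hi → ev p = some m → (∀ q, m ≠ Nat.pair 3 q) → p ∈ S) :
    (covered n lo hi e ev).toFinset.card ≤ ∑ p ∈ S, 2 ^ (n - max lo p.length - e - 1) := by
  let inputs (p : List Bool) : List (List Bool) :=
    (ev p).toList.flatMap (thinInputs n (n - max lo p.length - e - 1))
  have hsub : (covered n lo hi e ev).toFinset ⊆ S.biUnion fun p => (inputs p).toFinset := by
    intro y hy
    obtain ⟨p, hp, m, hm, hym⟩ := mem_covered.1 (List.mem_toFinset.1 hy)
    refine Finset.mem_biUnion.2 ⟨p, hS p m hp hm ?_, by simpa [inputs, hm] using hym⟩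
    rintro q rfl
    simp [thinInputs, fastInputs_pair_three] at hym
  refine (Finset.card_le_card hsub).trans (Finset.card_biUnion_le.trans
    (Finset.sum_le_sum fun p _ => (List.toFinset_card_le _).trans ?_))
  cases hp : ev p with
  | none => simp [inputs, hp]
  | some m => simpa [inputs, hp] using length_thinInputs_le ..

theorem card_toFinset_covered_zero_le (h : hi + e < n) :
    (covered n 0 hi e ev).toFinset.card ≤ (hi + 1) * 2 ^ (n - e - 1) := by
  refine (card_toFinset_covered_le (S := (programs (hi + 1)).toFinset) fun p _ hp _ _ =>
    List.mem_toFinset.2 (mem_programs.2 (Nat.lt_succ_of_le hp))).trans ?_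
  simp only [Nat.zero_max]
  rw [sum_toFinset_programs _ fun l => 2 ^ (n - l - e - 1)]
  refine (Finset.sum_le_card_nsmul _ _ (2 ^ (n - e - 1)) fun l hl => ?_).trans (by simp)
  rw [← pow_add]
  have := Finset.mem_range.1 hl
  exact Nat.pow_le_pow_right two_pos (by omega)

theorem card_toFinset_covered_self_le {α : ℕ} {S : Finset (List Bool)}
    (hS : ∀ p m, p.length ≤ α → ev p = some m → (∀ q, m ≠ Nat.pair 3 q) → p ∈ S)
    (hlen : ∀ p ∈ S, p.length ≤ α) :
    (covered n α α 0 ev).toFinset.card ≤ S.card * 2 ^ (n - α - 1) := by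
  refine (card_toFinset_covered_le hS).trans
    (Finset.sum_le_card_nsmul _ _ _ fun p hp => ?_)
  rw [max_eq_left (hlen p hp), Nat.sub_zero]

theorem Protocol.Computes.toList_mem_covered {P : Protocol n} (hP : P.Computes identity)
    {x y : Str n} {p : List Bool} (hp : p.length ≤ hi) (hcode : ev p = some P.code)
    (h : P.cost x y + max lo p.length + e < n) : y.toList ∈ covered n lo hi e ev :=
  mem_covered.2 ⟨p, hp, P.code, hcode, hP.toList_mem_thinInputs (x := x) (by omega)⟩

end Covered

/-! ### Strings of every complexity that cannot be sent fast -/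

theorem encode_quadruple_lt {n a b c d : ℕ} (ha : a ≤ n) (hb : b ≤ n) (hc : c ≤ n) (hd : d ≤ n) :
    Encodable.encode (a, b, c, d) < (n + 1) ^ 8 := by
  have hpair {N i j : ℕ} (hi : i < N) (hj : j < N) : Nat.pair i j < N ^ 2 :=
    (Nat.pair_lt_max_add_one_sq i j).trans_le (Nat.pow_le_pow_left (Nat.succ_le_of_lt
      (max_lt hi hj)) 2)
  have hpow (i : ℕ) : n + 1 ≤ (n + 1) ^ (i + 1) := Nat.le_self_pow (Nat.succ_ne_zero i) _
  have hcd : Nat.pair c d < (n + 1) ^ 2 := hpair (by omega) (by omega)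
  have hbcd : Nat.pair b (Nat.pair c d) < ((n + 1) ^ 2) ^ 2 :=
    hpair ((Nat.lt_succ_of_le hb).trans_le (hpow 1)) hcd
  rw [← pow_mul] at hbcd
  rw [show 8 = 4 * 2 by norm_num, pow_mul]
  exact hpair ((Nat.lt_succ_of_le ha).trans_le (hpow 3)) hbcd

theorem weight_quadruple_le {n a b c d : ℕ} (ha : a ≤ n) (hb : b ≤ n) (hc : c ≤ n) (hd : d ≤ n) :
    (Encodable.encode (a, b, c, d) + 1) * (Encodable.encode (a, b, c, d) + 2) ≤
      2 ^ (32 * Nat.log 2 (n + 2)) := by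
  have hcode := encode_quadruple_lt ha hb hc hd
  have hpow : (n + 1) ^ 8 + 1 ≤ (n + 2) ^ 8 :=
    Nat.succ_le_of_lt (Nat.pow_lt_pow_left (by omega) (by norm_num))
  have hlog : 1 ≤ Nat.log 2 (n + 2) := Nat.log_pos one_lt_two (by omega)
  calc _ ≤ (n + 2) ^ 8 * (n + 2) ^ 8 := Nat.mul_le_mul (by omega) (by omega)
    _ = (n + 2) ^ 16 := by rw [← pow_add]
    _ ≤ (2 ^ (Nat.log 2 (n + 2) + 1)) ^ 16 :=
      Nat.pow_le_pow_left (Nat.lt_pow_succ_log_self one_lt_two _).le 16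
    _ ≤ 2 ^ (32 * Nat.log 2 (n + 2)) := by
      rw [← pow_mul]
      exact Nat.pow_le_pow_right two_pos (by omega)

theorem le_TCC_identity_add {U : Machine} {n α e : ℕ} {x y : Str n}
    (h : ∀ (P : Protocol n) (p : List Bool), P.Computes identity → P.code ∈ U p n →
      p.length ≤ α → n ≤ P.cost x y + α + e) : n ≤ TCC U identity α x y + α + e := by
  rw [← tsub_le_iff_right, ← tsub_le_iff_right]
  refine le_iInf₂ fun P hP => ?_
  obtain ⟨p, hp, hcode⟩ := condC_le_iff.1 hP.2
  rw [tsub_le_iff_right, tsub_le_iff_right]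
  exact_mod_cast h P p hP.1 hcode hp

theorem IsOptimal.exists_le_TCC_identity {U : Machine} (hU : IsOptimal U)
    (A : Approximation U) (r : ℕ) :
    ∃ c : ℕ, ∀ n k lo hi e : ℕ, lo ≤ n → e ≤ n → hi + 33 * Nat.log 2 (n + 2) ≤ k → k ≤ n →
      (∀ T, (covered n lo hi e (A.run T n)).toFinset.card + 2 ^ (k - r) ≤ 2 ^ n) →
      ∃ y : Str n, strC U y.toList ≤ k + c ∧ k ≤ strC U y.toList + r ∧
        ∀ (x : Str n) (α : ℕ), lo ≤ α → α ≤ hi → n ≤ TCC U identity α x y + α + e := by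
  have hcovered : Primrec₂ fun (t : ℕ × ℕ × ℕ × ℕ) T =>
      covered t.1 t.2.1 t.2.2.1 t.2.2.2 (A.run T t.1) := by
    have hlo : Primrec fun t : ℕ × ℕ × ℕ × ℕ => t.2.1 := Primrec.fst.comp Primrec.snd
    have hhi : Primrec fun t : ℕ × ℕ × ℕ × ℕ => t.2.2.1 :=
      Primrec.fst.comp (Primrec.snd.comp Primrec.snd)
    have he : Primrec fun t : ℕ × ℕ × ℕ × ℕ => t.2.2.2 :=
      Primrec.snd.comp (Primrec.snd.comp Primrec.snd)
    exact primrec_covered (Primrec.fst.comp Primrec.fst) (hlo.comp Primrec.fst)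
      (hhi.comp Primrec.fst) (he.comp Primrec.fst) (A.primrec_run.comp
      ((Primrec.snd.comp Primrec.fst).pair ((Primrec.fst.comp (Primrec.fst.comp Primrec.fst)).pair
      Primrec.snd))).to₂
  obtain ⟨c, hc⟩ := hU.exists_eventually_notMem (w := fun t : ℕ × ℕ × ℕ × ℕ => t.2.2.1 + 1) r
    Primrec.fst (Primrec.succ.comp (Primrec.fst.comp (Primrec.snd.comp Primrec.snd))) hcovered
    fun t => A.encard_range_le _ _ _ fun _ _ => covered_congr
  refine ⟨c, fun n k lo hi e hlo he hhi hk hcard => ?_⟩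
  have hlog : 1 ≤ Nat.log 2 (n + 2) := Nat.log_pos one_lt_two (by omega)
  have hweight : 2 ^ (hi + 1) * ((Encodable.encode (n, lo, hi, e) + 1) *
      (Encodable.encode (n, lo, hi, e) + 2)) ≤ 2 ^ k := by
    refine (Nat.mul_le_mul_left _ (weight_quadruple_le le_rfl hlo (by omega) he)).trans ?_
    rw [← pow_add]
    exact Nat.pow_le_pow_right two_pos (by omega)
  obtain ⟨T, hT, y, hy, hupper, hlower⟩ := ((A.eventually_forall_run_eq_some (hi + 1) n).and
    (hc (n, lo, hi, e) k hweight hcard)).exists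
  refine ⟨y, hupper, hlower, fun x α hα hα' => le_TCC_identity_add fun P p hP hcode hp => ?_⟩
  by_contra! hlt
  have hfast : P.cost x y + max lo p.length + e < n := by omega
  have hp' : p.length ≤ hi := hp.trans hα'
  exact hy (hP.toList_mem_covered hp' (hT p (mem_programs.2 (by omega)) _ hcode) hfast)

/-- No protocol has a code of the form `Nat.pair 3 q`, so a program with such an output covers
nothing, and a fixed fraction of all programs have such outputs. -/
theorem IsOptimal.exists_card_toFinset_covered_self_add_le {U : Machine} (hU : IsOptimal U)
    (A : Approximation U) : ∃ c : ℕ, ∀ n α T : ℕ, α < n →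
      (covered n α α 0 (A.run T n)).toFinset.card + 2 ^ (n - (c + 1)) ≤ 2 ^ n := by
  classical
  have hdead : Computable fun q : List Bool => Nat.pair 3 (Encodable.encode q) :=
    (Primrec₂.natPair.comp (Primrec.const 3) Primrec.encode).to_comp
  obtain ⟨c, hc⟩ := hU.exists_card_add_pow_le hdead fun q q' h =>
    Encodable.encode_injective (Nat.pair_eq_pair.1 h).2
  refine ⟨c, fun n α T hα => ?_⟩
  let S : Finset (List Bool) :=
    {p ∈ (programs (α + 1)).toFinset | ∀ q : List Bool, Nat.pair 3 (Encodable.encode q) ∉ U p n}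
  have hlen : ∀ p ∈ S, p.length ≤ α := fun p hp =>
    Nat.lt_succ_iff.1 (mem_programs.1 (List.mem_toFinset.1 (Finset.mem_filter.1 hp).1))
  have hcovered : (covered n α α 0 (A.run T n)).toFinset.card ≤ S.card * 2 ^ (n - α - 1) := by
    refine card_toFinset_covered_self_le (fun p m hp hm hne => ?_) hlen
    refine Finset.mem_filter.2 ⟨List.mem_toFinset.2 (mem_programs.2 (Nat.lt_succ_of_le hp)), ?_⟩
    exact fun q hq => hne _ (Part.mem_unique (A.mem_iff.2 ⟨T, hm⟩) hq)
  calc _ ≤ S.card * 2 ^ (n - α - 1) + 2 ^ (α - c) * 2 ^ (n - α - 1) := by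
        rw [← pow_add]
        exact Nat.add_le_add hcovered (Nat.pow_le_pow_right two_pos (by omega))
    _ = (S.card + 2 ^ (α - c)) * 2 ^ (n - α - 1) := (add_mul _ _ _).symm
    _ ≤ 2 ^ (α + 1) * 2 ^ (n - α - 1) :=
      Nat.mul_le_mul_right _ (hc n α S fun p hp => ⟨hlen p hp, (Finset.mem_filter.1 hp).2⟩)
    _ = 2 ^ n := by rw [← pow_add, Nat.sub_sub, Nat.add_sub_cancel' hα]

theorem card_toFinset_covered_zero_add_le {n hi : ℕ} (ev : List Bool → Option ℕ)
    (h : hi + 3 * Nat.log 2 (n + 2) < n) :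
    (covered n 0 hi (3 * Nat.log 2 (n + 2)) ev).toFinset.card + 2 ^ (n - 1) ≤ 2 ^ n := by
  have hlog : 1 ≤ Nat.log 2 (n + 2) := Nat.log_pos one_lt_two (by omega)
  have hhi : hi + 1 ≤ 2 ^ (Nat.log 2 (n + 2) + 1) := by
    have := Nat.lt_pow_succ_log_self one_lt_two (n + 2)
    omega
  calc _ ≤ 2 ^ (Nat.log 2 (n + 2) + 1) * 2 ^ (n - 3 * Nat.log 2 (n + 2) - 1) + 2 ^ (n - 1) :=
        Nat.add_le_add_right ((card_toFinset_covered_zero_le h).trans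
          (Nat.mul_le_mul_right _ hhi)) _
    _ ≤ 2 ^ (n - 1) + 2 ^ (n - 1) := by
        rw [← pow_add]
        exact Nat.add_le_add_right (Nat.pow_le_pow_right two_pos (by omega)) _
    _ = 2 ^ n := by rw [← two_mul, mul_pow_sub_one (by omega)]

theorem add_mul_le_of_lt {a : ℕ∞} {α k L m c c' : ℕ} (hL : 1 ≤ L) (hc : m + c' ≤ c)
    (ha : a ≤ k + c') (h : (α + c * L : ℕ) < a) : α + m * L ≤ k := by
  have hlt : α + c * L < k + c' := by exact_mod_cast h.trans_le ha
  have hcL : (m + c') * L ≤ c * L := Nat.mul_le_mul_right L hc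
  have hc' : c' ≤ c' * L := Nat.le_mul_of_pos_right c' hL
  rw [add_mul] at hcL
  omega

theorem IsOptimal.eventually_exists_forall_le_TCC_identity {U : Machine} (hU : IsOptimal U) :
    ∀ᶠ c : ℕ in Filter.atTop, ∀ n k : ℕ, c * Nat.log 2 (n + 2) ≤ k → k ≤ n →
      ∃ y : Str n, strC U y.toList ≤ k + c ∧ k ≤ strC U y.toList + c ∧
        ∀ (x : Str n) (α : ℕ), (α + c * Nat.log 2 (n + 2) : ℕ) < strC U y.toList →
          n ≤ TCC U identity α x y + α + (c * Nat.log 2 (n + 2) : ℕ) := by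
  obtain ⟨A⟩ := nonempty_approximation hU.1
  obtain ⟨c₀, hc₀⟩ := hU.exists_le_TCC_identity A 1
  filter_upwards [Filter.eventually_ge_atTop (33 + c₀)] with c hc n k hck hkn
  have hlog : 1 ≤ Nat.log 2 (n + 2) := Nat.log_pos one_lt_two (by omega)
  have hk : 33 * Nat.log 2 (n + 2) ≤ k := (Nat.mul_le_mul_right _ (by omega)).trans hck
  obtain ⟨y, hupper, hlower, hy⟩ := hc₀ n k 0 (k - 33 * Nat.log 2 (n + 2))
    (3 * Nat.log 2 (n + 2)) (Nat.zero_le n) (by omega) (by omega) hkn fun T =>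
    (Nat.add_le_add_left (Nat.pow_le_pow_right two_pos (by omega)) _).trans
      (card_toFinset_covered_zero_add_le _ (by omega))
  refine ⟨y, hupper.trans (by gcongr; omega), hlower.trans (by gcongr; omega),
    fun x α hα => (hy x α (Nat.zero_le α) ?_).trans (by gcongr; omega)⟩
  have := add_mul_le_of_lt hlog hc hupper hα
  omega

theorem IsOptimal.eventually_forall_exists_le_TCC_identity {U : Machine} (hU : IsOptimal U) :
    ∀ᶠ c : ℕ in Filter.atTop, ∀ n k : ℕ, c * Nat.log 2 (n + 2) ≤ k → k ≤ n →
      ∀ α : ℕ, ∃ y : Str n, strC U y.toList ≤ k + c ∧ k ≤ strC U y.toList + c ∧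
        ∀ x : Str n, (α + c * Nat.log 2 (n + 2) : ℕ) < strC U y.toList →
          n ≤ TCC U identity α x y + α := by
  obtain ⟨A⟩ := nonempty_approximation hU.1
  obtain ⟨r, hr⟩ := hU.exists_card_toFinset_covered_self_add_le A
  obtain ⟨c₀, hc₀⟩ := hU.exists_le_TCC_identity A (r + 1)
  filter_upwards [Filter.eventually_ge_atTop (33 + c₀ + r)] with c hc n k hck hkn α
  have hlog : 1 ≤ Nat.log 2 (n + 2) := Nat.log_pos one_lt_two (by omega)
  have hk : 33 * Nat.log 2 (n + 2) ≤ k := (Nat.mul_le_mul_right _ (by omega)).trans hck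
  let β := min α (k - 33 * Nat.log 2 (n + 2))
  obtain ⟨y, hupper, hlower, hy⟩ := hc₀ n k β β 0 (by omega) (Nat.zero_le n) (by omega) hkn
    fun T => (Nat.add_le_add_left (Nat.pow_le_pow_right two_pos (by omega)) _).trans
      (hr n β T (by omega))
  refine ⟨y, hupper.trans (by gcongr; omega), hlower.trans (by gcongr; omega),
    fun x hα => ?_⟩
  have := add_mul_le_of_lt hlog (by omega : 33 + c₀ ≤ c) hupper hα
  simpa using hy x α (min_le_left _ _) (by omega)

theorem IsOptimal.eventually_TCC_identity_le {U : Machine} (hU : IsOptimal U) :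
    ∀ᶠ c : ℕ in Filter.atTop, ∀ (n : ℕ) (x y : Str n) (α : ℕ), strC U y.toList + c ≤ α →
      TCC U identity α x y ≤ c := by
  obtain ⟨c₀, hc₀⟩ := hU.exists_TCC_identity_le_one
  filter_upwards [Filter.eventually_ge_atTop (c₀ + 1)] with c hc n x y α hα
  refine (hc₀ n x y α (le_trans ?_ hα)).trans ?_
  · gcongr; omega
  · exact_mod_cast (by omega : 1 ≤ c)

end IndividualCC

open IndividualCC in
theorem mainTheorem3 (U : Machine) (hU : IsOptimal U) :
    ∃ c : ℕ,
      (∀ n k : ℕ, c * Nat.log 2 (n + 2) ≤ k → k ≤ n →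
        -- one string for all `α`, up to logarithmic precision
        (∃ y : Str n, strC U y.toList ≤ k + c ∧ k ≤ strC U y.toList + c ∧
          ∀ (x : Str n) (α : ℕ), (α + c * Nat.log 2 (n + 2) : ℕ) < strC U y.toList →
            n ≤ TCC U identity α x y + α + (c * Nat.log 2 (n + 2) : ℕ)) ∧
        -- for a given `α`, a string with the exact bound
        (∀ α : ℕ, ∃ y : Str n, strC U y.toList ≤ k + c ∧ k ≤ strC U y.toList + c ∧
          ∀ x : Str n, (α + c * Nat.log 2 (n + 2) : ℕ) < strC U y.toList →
            n ≤ TCC U identity α x y + α)) ∧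
      (∀ (n : ℕ) (x y : Str n) (α : ℕ), strC U y.toList + c ≤ α →
        TCC U identity α x y ≤ c) := by
  obtain ⟨c, huniform, hexact, hupper⟩ := (hU.eventually_exists_forall_le_TCC_identity.and
    (hU.eventually_forall_exists_le_TCC_identity.and hU.eventually_TCC_identity_le)).exists
  exact ⟨c, fun n k hk hkn => ⟨huniform n k hk hkn, hexact n k hk hkn⟩, hupper⟩
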